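/- Let $d\ge 1$, let $B_R\subset\mathbb R^d$ be the open Euclidean ball of radius $R$ centred at $0$, and let $X\subset\mathbb R^d$ be uniformly discrete: there is $r>0$ with $|x-y|\ge r$ for all distinct $x,y\in X$. Assume: (H.1) there is a constant $\mathrm{dens}(X)>0$ with $\#(X\cap B_R)-\mathrm{dens}(X)\,\mathrm{Vol}(B_R)=o(R^d)$ as $R\to\infty$; (H.2) the diffraction measure of $X$ exists and is singular with respect to Lebesgue measure, i.e. there is a positive Radon measure $\widehat{\gamma_X}$ on $\mathbb R^d$, singular with respect to Lebesgue measure, such that for all $f\in C_c^\infty(\mathbb R^d)$ $$\int f\,d\widehat{\gamma_X}=\lim_{R\to\infty}\frac1{\mathrm{Vol}(B_R)}\int_{\mathbb R^d} f(\lambda)\Bigl|\sum_{p\in X\cap B_R}e^{-2\pi i\langle p,\lambda\rangle}\Bigr|^2d\lambda .$$ Let $(\xi_p)_{p\in X}$ be i.i.d. random vectors in $\mathbb R^d$, with the law of a random vector $\xi$ such that $\mathbb E|\xi|^{d+\varepsilon}<\infty$ for some $\varepsilon>0$. Let $X_\xi$ be the perturbed configuration $\{p+\xi_p:p\in X\}$,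 its points counted with multiplicity, and put $$M_R(\lambda)=\frac1{\mathrm{Vol}(B_R)}\sum_{p\in X:\ p+\xi_p\in B_R}e^{-2\pi i\langle p+\xi_p,\lambda\rangle},\qquad S_R(\lambda)=\frac1{\mathrm{Vol}(B_R)}\sum_{p\in X\cap B_R}e^{-2\pi i\langle p,\lambda\rangle}.$$ Then almost surely $X_\xi$ has finitely many points in every $B_R$, and for every $\lambda\in\mathbb R^d$ $$\lim_{R\to\infty}\Bigl(M_R(\lambda)-\mathbb E\bigl[e^{-2\pi i\langle\xi,\lambda\rangle}\bigr]\,S_R(\lambda)\Bigr)=0 .$$ Consequently, almost surely, for every $\lambda$ at which the weak Fourier transform $\widehat{\delta_X}(\lambda):=\lim_{R\to\infty}S_R(\lambda)$ exists, $$\lim_{R\to\infty}M_R(\lambda)=\mathbb E\bigl[e^{-2\pi i\langle\xi,\lambda\rangle}\bigr]\,\widehat{\delta_X}(\lambda).$$ Moreover, almost surely, the (complex) measures $\bigl(M_R(\lambda)-\mathbb E[e^{-2\pi i\langle\xi,\lambda\rangle}]\,S_R(\lambda)\bigr)\,d\lambda$ converge vaguely to $0$ as $R\to\infty$. -/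

import Mathlib

open MeasureTheory ProbabilityTheory Filter Topology Asymptotics

noncomputable section

namespace PerturbedSet

open scoped ContDiff

/-- Euclidean space `ℝ^d`. -/
abbrev E (d : ℕ) : Type := EuclideanSpace ℝ (Fin d)

variable {d : ℕ}

/-- The Lebesgue volume of the open ball `B_R` of radius `R` centred at the origin of `ℝ^d`. -/
def volBall (d : ℕ) (R : ℝ) : ℝ := (volume : Measure (E d)).real (Metric.ball 0 R)

/-- The character `e^{-2πi⟨x,k⟩}`. -/
def character (k x : E d) : ℂ :=
  Complex.exp (-2 * (Real.pi : ℂ) * Complex.I * ((inner ℝ x k : ℝ) : ℂ))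

/-- Distinct points of `X` are at distance at least some fixed `r > 0`. -/
def UniformlyDiscrete (X : Set (E d)) : Prop :=
  ∃ r : ℝ, 0 < r ∧ ∀ x ∈ X, ∀ y ∈ X, x ≠ y → r ≤ dist x y

/-- `X` has a (positive) asymptotic density:
`#(X ∩ B_R) - dens · Vol(B_R) = o(R^d)` as `R → ∞`. -/
def HasAsymptoticDensity (X : Set (E d)) : Prop :=
  ∃ dens : ℝ, 0 < dens ∧
    (fun R : ℝ => ((X ∩ Metric.ball 0 R).ncard : ℝ) - dens * volBall d R)
      =o[atTop] (fun R : ℝ => R ^ d)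

/-- The exponential sum `∑_{p ∈ X ∩ B_R} e^{-2πi⟨p,k⟩}`
(a finite sum for uniformly discrete `X`). -/
def expSum (X : Set (E d)) (R : ℝ) (k : E d) : ℂ :=
  ∑ᶠ p ∈ X ∩ Metric.ball 0 R, character k p

/-- `γ` is the diffraction measure of `∑_{p ∈ X} δ_p`: a positive Radon measure that is the limit of
the measures `Vol(B_R)⁻¹ |∑_{p ∈ X ∩ B_R} e^{-2πi⟨p,k⟩}|² dk`, tested on `C_c^∞`. -/
def IsDiffractionMeasure (X : Set (E d)) (γ : Measure (E d)) : Prop :=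
  IsLocallyFiniteMeasure γ ∧
    ∀ f : E d → ℝ, ContDiff ℝ ∞ f → HasCompactSupport f →
      Tendsto (fun R : ℝ => (volBall d R)⁻¹ * ∫ k, f k * ‖expSum X R k‖ ^ 2)
        atTop (𝓝 (∫ k, f k ∂γ))

/-- The diffraction measure of `X` exists and is singular with respect to Lebesgue measure. -/
def HasSingularDiffraction (X : Set (E d)) : Prop :=
  ∃ γ : Measure (E d), IsDiffractionMeasure X γ ∧ γ ⟂ₘ (volume : Measure (E d))

/-- The normalized exponential sum `Vol(B_R)⁻¹ ∑_{p ∈ X ∩ B_R} e^{-2πi⟨p,k⟩}` of `X`. -/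
def meanExp (X : Set (E d)) (R : ℝ) (k : E d) : ℂ :=
  ((volBall d R : ℝ) : ℂ)⁻¹ * expSum X R k

/-- The weak Fourier transform of `∑_{p ∈ X} δ_p` exists at `k`, with value `a`. -/
def HasWeakFourier (X : Set (E d)) (k : E d) (a : ℂ) : Prop :=
  Tendsto (fun R : ℝ => meanExp X R k) atTop (𝓝 a)

/-- The normalized exponential sum `M_R(k)` of the perturbed configuration `{p + v p : p ∈ X}`,
the points being counted with multiplicity (that is, the sum of `e^{-2πi⟨x,k⟩}` over `B_R`
against `∑_{p ∈ X} δ_{p + v p}`). -/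
def perturbedMeanExp (X : Set (E d)) (v : X → E d) (R : ℝ) (k : E d) : ℂ :=
  ((volBall d R : ℝ) : ℂ)⁻¹ *
    ∑ᶠ (p : X) (_ : (p : E d) + v p ∈ Metric.ball (0 : E d) R), character k ((p : E d) + v p)

end PerturbedSet

end

open PerturbedSet

/-!
Let `φ(k) = 𝔼[e^{-2πi⟨ξ,k⟩}]`. The difference `M_R(k) - φ(k) S_R(k)` is `Vol(B_R)⁻¹` times the sum
over `p ∈ X ∩ B_R` of the independent centred variables
`e^{-2πi⟨p + ξ_p,k⟩} - φ(k) e^{-2πi⟨p,k⟩}`, up to an error of at most the number of points that the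
perturbation moves across the sphere of radius `R`.

If all points were displaced by the same vector `x`, those crossing the sphere would lie in a shell
of width `2‖x‖`, which by a packing argument contains `o(R^d)` of them. Averaging over the law of
`ξ`, by dominated convergence, shows that the mean number of crossing points is `o(R^d)` for every
law, and a Chernoff bound makes this almost sure along the integers. Hoeffding's inequality bounds
the sum of centred variables at a fixed `k` with probability `1 - O(e^{-cR^d})`. This survives a
union bound over nets of polynomial cardinality in growing balls, so that a single null set serves
all `k`. Passing from integers to real radii costs only a shell of width `2`.
-/

namespace PerturbedSet

variable {d : ℕ}

section Packing

open Metric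

lemma finite_and_ncard_le_of_encard_le_ofReal {α : Type*} {s : Set α} {x : ℝ} (hx : 0 ≤ x)
    (h : (s.encard : ENNReal) ≤ ENNReal.ofReal x) : s.Finite ∧ (s.ncard : ℝ) ≤ x := by
  have hs : s.Finite := by
    refine Set.encard_ne_top_iff.1 fun htop => ?_
    simp only [htop, ENat.toENNReal_top, top_le_iff, ENNReal.ofReal_ne_top] at h
  refine ⟨hs, ?_⟩
  rw [← hs.cast_ncard_eq, ENat.toENNReal_coe] at h
  simpa using ENNReal.toReal_le_of_le_ofReal hx h

variable {V : Type*} [NormedAddCommGroup V] {ι : Type*} {y : ι → V} {r R : ℝ} {s : Set ι}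

lemma encard_mul_measure_ball_le [MeasurableSpace V] [BorelSpace V] (μ : Measure V)
    [μ.IsAddHaarMeasure] (hy : Pairwise fun i j => r ≤ dist (y i) (y j)) {U : Set V}
    (hU : ∀ i ∈ s, ball (y i) (r / 2) ⊆ U) :
    (s.encard : ENNReal) * μ (ball 0 (r / 2)) ≤ μ U := by
  have hdisj : Pairwise (Function.onFun Disjoint fun i : s => ball (y i) (r / 2)) := fun i j hij =>
    ball_disjoint_ball ((add_halves r).trans_le (hy (Subtype.coe_injective.ne hij)))
  calc (s.encard : ENNReal) * μ (ball 0 (r / 2)) = ∑' i : s, μ (ball (y i) (r / 2)) := by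
        simp only [Measure.addHaar_ball_center, ENNReal.tsum_set_const]
    _ ≤ μ (⋃ i : s, ball (y i) (r / 2)) :=
        tsum_meas_le_meas_iUnion_of_disjoint μ (fun _ => measurableSet_ball) hdisj
    _ ≤ μ U := measure_mono (Set.iUnion_subset fun i => hU i i.2)

variable [NormedSpace ℝ V] [FiniteDimensional ℝ V]

lemma encard_le_of_measure_le [MeasurableSpace V] [BorelSpace V] (μ : Measure V)
    [μ.IsAddHaarMeasure] (hr : 0 < r) (hy : Pairwise fun i j => r ≤ dist (y i) (y j)) {U : Set V}
    (hU : ∀ i ∈ s, ball (y i) (r / 2) ⊆ U) {c : ℝ}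
    (hc : μ U ≤ ENNReal.ofReal c * μ (ball 0 1)) :
    (s.encard : ENNReal) ≤ ENNReal.ofReal (c / (r / 2) ^ Module.finrank ℝ V) := by
  have hvol : μ (ball (0 : V) 1) ≠ 0 := (measure_ball_pos μ 0 one_pos).ne'
  rw [ENNReal.ofReal_div_of_pos (by positivity),
    ENNReal.le_div_iff_mul_le (by left; positivity) (.inl ENNReal.ofReal_ne_top),
    ← ENNReal.mul_le_mul_iff_left hvol measure_ball_lt_top.ne, mul_assoc,
    ← Measure.addHaar_ball_of_pos μ 0 (half_pos hr)]
  exact (encard_mul_measure_ball_le μ hy hU).trans hc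

lemma encard_le_of_dist_le (hr : 0 < r) (hy : Pairwise fun i j => r ≤ dist (y i) (y j)) (x : V)
    (hR : 0 ≤ R) (hs : ∀ i ∈ s, dist (y i) x ≤ R) :
    (s.encard : ENNReal) ≤ ENNReal.ofReal ((2 * R / r + 1) ^ Module.finrank ℝ V) := by
  borelize V
  have hsub (i : ι) (hi : i ∈ s) : ball (y i) (r / 2) ⊆ ball x (R + r / 2) :=
    ball_subset_ball' (by linarith [hs i hi])
  have hratio : 2 * R / r + 1 = (R + r / 2) / (r / 2) := by field_simp
  rw [hratio, div_pow]
  exact encard_le_of_measure_le Measure.addHaar hr hy hsub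
    (Measure.addHaar_ball_of_pos _ x (by positivity)).le

lemma encard_le_of_norm_mem_Icc (hr : 0 < r) (hy : Pairwise fun i j => r ≤ dist (y i) (y j))
    {a b : ℝ} (ha : r / 2 ≤ a) (hab : a ≤ b) (hs : ∀ i ∈ s, ‖y i‖ ∈ Set.Icc a b) :
    (s.encard : ENNReal) ≤ ENNReal.ofReal
      ((2 * b / r + 1) ^ Module.finrank ℝ V - (2 * a / r - 1) ^ Module.finrank ℝ V) := by
  borelize V
  have hsub (i : ι) (hi : i ∈ s) :
      ball (y i) (r / 2) ⊆ ball 0 (b + r / 2) \ closedBall 0 (a - r / 2) := by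
    intro z hz
    have hyi := hs i hi
    rw [mem_ball_iff_norm] at hz
    rw [Set.mem_sdiff, mem_ball_zero_iff, mem_closedBall_zero_iff, not_le]
    exact ⟨by linarith [norm_sub_norm_le z (y i), hyi.2],
      by linarith [norm_sub_norm_le (y i) z, norm_sub_rev z (y i), hyi.1]⟩
  have hratio_b : 2 * b / r + 1 = (b + r / 2) / (r / 2) := by field_simp
  have hratio_a : 2 * a / r - 1 = (a - r / 2) / (r / 2) := by field_simp
  rw [hratio_b, hratio_a, div_pow (b + _), div_pow (a - _), ← sub_div]
  refine encard_le_of_measure_le Measure.addHaar hr hy hsub ?_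
  have hinner : 0 ≤ a - r / 2 := by linarith
  rw [measure_sdiff (closedBall_subset_ball (by linarith))
      measurableSet_closedBall.nullMeasurableSet measure_closedBall_lt_top.ne,
    Measure.addHaar_ball_of_pos _ _ (by linarith), Measure.addHaar_closedBall _ _ hinner,
    ENNReal.ofReal_sub _ (by positivity), ENNReal.sub_mul fun _ _ => measure_ball_lt_top.ne]

lemma exists_finset_net (hR : 0 ≤ R) {δ : ℝ} (hδ : 0 < δ) :
    ∃ N : Finset V, (N.card : ℝ) ≤ (2 * R / δ + 1) ^ Module.finrank ℝ V ∧
      ∀ x, ‖x‖ ≤ R → ∃ z ∈ N, dist x z ≤ δ := by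
  lift δ to NNReal using hδ.le
  set B : ℝ := (2 * R / δ + 1) ^ Module.finrank ℝ V
  have hcard {C : Set V} (hCR : C ⊆ closedBall 0 R) (hC : IsSeparated δ C) :
      C.Finite ∧ (C.ncard : ℝ) ≤ B := by
    have hdist : Pairwise fun i j : C => (δ : ℝ) ≤ dist (i : V) j := fun i j hij => by
      have hij' : (δ : ENNReal) < edist (i : V) j := hC i.2 j.2 (Subtype.coe_injective.ne hij)
      rw [edist_nndist, ENNReal.coe_lt_coe] at hij'
      exact_mod_cast hij'.le
    refine finite_and_ncard_le_of_encard_le_ofReal (by positivity) ?_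
    simpa using encard_le_of_dist_le (s := Set.univ) hδ hdist 0 hR fun i _ => hCR i.2
  have hpacking : packingNumber δ (closedBall (0 : V) R) ≤ ⌊B⌋₊ :=
    iSup_le fun C => iSup₂_le fun hCR hC => by
      rw [← (hcard hCR hC).1.cast_ncard_eq]
      exact_mod_cast Nat.le_floor (hcard hCR hC).2
  obtain ⟨hfin, hle⟩ := hcard maximalSeparatedSet_subset isSeparated_maximalSeparatedSet
  refine ⟨hfin.toFinset, by rwa [← Set.ncard_eq_toFinset_card _ hfin], fun x hx => ?_⟩
  have hcover : IsCover δ (closedBall (0 : V) R) (maximalSeparatedSet δ (closedBall 0 R)) :=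
    isCover_maximalSeparatedSet (ne_top_of_le_ne_top (ENat.natCast_ne_top _) hpacking)
  obtain ⟨z, hz, hxz⟩ := hcover (mem_closedBall_zero_iff.2 hx)
  have hxz' : edist x z ≤ δ := hxz
  rw [edist_nndist, ENNReal.coe_le_coe] at hxz'
  exact ⟨z, hfin.mem_toFinset.2 hz, hxz'⟩

end Packing

section Counting

variable {X : Set (E d)} {v : X → E d} {R h : ℝ}

/-- The points of `X` whose displacement by `v` lies in `B_R`, as a set of indices, so that
multiplicities are kept; `pointsIn 0 R` is `X ∩ B_R`. -/
def pointsIn (v : X → E d) (R : ℝ) : Set X := {p | (p : E d) + v p ∈ Metric.ball 0 R}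

/-- The points that enter or leave `B_R` when `X` is displaced by `v`. -/
def crossing (v : X → E d) (R : ℝ) : Set X := symmDiff (pointsIn v R) (pointsIn 0 R)

/-- The points of `X` at distance at most `h` from the sphere of radius `R`. -/
def shell (X : Set (E d)) (R h : ℝ) : Set X := {p | |‖(p : E d)‖ - R| ≤ h}

/-- The points crossing the sphere of radius `R` are `o(R^d)` in number. Finiteness is required
separately because `Set.ncard` vanishes on infinite sets. -/
def HasNegligibleCrossing (v : X → E d) : Prop :=
  (∀ R, (crossing v R).Finite) ∧
    (fun R : ℝ => ((crossing v R).ncard : ℝ)) =o[atTop] fun R : ℝ => R ^ d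

lemma mem_pointsIn {p : X} : p ∈ pointsIn v R ↔ ‖(p : E d) + v p‖ < R :=
  mem_ball_zero_iff

lemma mem_pointsIn_zero {p : X} : p ∈ pointsIn 0 R ↔ ‖(p : E d)‖ < R := by
  simp only [mem_pointsIn, Pi.zero_apply, add_zero]

lemma mem_crossing {p : X} : p ∈ crossing v R ↔
    ‖(p : E d) + v p‖ < R ∧ R ≤ ‖(p : E d)‖ ∨ ‖(p : E d)‖ < R ∧ R ≤ ‖(p : E d) + v p‖ := by
  simp only [crossing, Set.mem_symmDiff, mem_pointsIn_zero, mem_pointsIn (v := v), not_lt]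

lemma mem_shell {p : X} : p ∈ shell X R h ↔ -h ≤ ‖(p : E d)‖ - R ∧ ‖(p : E d)‖ - R ≤ h := by
  rw [shell, Set.mem_ofPred_eq, abs_le]

lemma pointsIn_mono (v : X → E d) {R S : ℝ} (h : R ≤ S) : pointsIn v R ⊆ pointsIn v S :=
  fun _ hp => mem_pointsIn.2 ((mem_pointsIn.1 hp).trans_le h)

lemma pointsIn_subset_crossing_union (v : X → E d) (R : ℝ) :
    pointsIn v R ⊆ crossing v R ∪ pointsIn 0 R := by
  intro p hp
  by_cases h0 : p ∈ pointsIn 0 R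
  · exact .inr h0
  · exact .inl (.inl ⟨hp, h0⟩)

lemma crossing_subset_shell (x : E d) (R : ℝ) :
    crossing (fun _ : X => x) R ⊆ shell X R ‖x‖ := by
  intro p hp
  have h1 := norm_sub_le ((p : E d) + x) x
  have h2 := norm_add_le (p : E d) x
  rw [add_sub_cancel_right] at h1
  rw [mem_shell]
  rcases mem_crossing.1 hp with hp | hp <;> constructor <;> linarith [norm_nonneg x]

lemma crossing_subset_floor (v : X → E d) (hR : 0 ≤ R) :
    crossing v R ⊆ crossing v ⌊R⌋₊ ∪ crossing v ((⌊R⌋₊ + 1 : ℕ) : ℝ) ∪ shell X R 1 := by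
  intro p hp
  have hfloor := Nat.floor_le hR
  have hlt := Nat.lt_floor_add_one R
  simp only [Set.mem_union, mem_crossing, mem_shell, Nat.cast_add_one] at hp ⊢
  generalize ‖(p : E d)‖ = a, ‖(p : E d) + v p‖ = b at hp ⊢
  grind

lemma UniformlyDiscrete.exists_pairwise_le_dist (hX : UniformlyDiscrete X) :
    ∃ r : ℝ, 0 < r ∧ Pairwise fun p q : X => r ≤ dist (p : E d) q := by
  obtain ⟨r, hr, h⟩ := hX
  exact ⟨r, hr, fun p q hpq => h p p.2 q q.2 (Subtype.coe_injective.ne hpq)⟩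

lemma UniformlyDiscrete.exists_encard_le (hX : UniformlyDiscrete X) :
    ∃ C : ℝ, 0 ≤ C ∧ ∀ R : ℝ, 1 ≤ R → ∀ x : E d,
      ({p : X | dist (p : E d) x ≤ R}.encard : ENNReal) ≤ ENNReal.ofReal (C * R ^ d) := by
  obtain ⟨r, hr, hdist⟩ := hX.exists_pairwise_le_dist
  refine ⟨(2 / r + 1) ^ d, by positivity, fun R hR x => ?_⟩
  refine (encard_le_of_dist_le hr hdist x (by linarith) fun p hp => hp).trans ?_
  rw [finrank_euclideanSpace_fin, ← mul_pow]
  gcongr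
  rw [add_mul, one_mul, div_mul_eq_mul_div]
  gcongr

lemma UniformlyDiscrete.finite_pointsIn_zero (hX : UniformlyDiscrete X) (R : ℝ) :
    (pointsIn (0 : X → E d) R).Finite := by
  obtain ⟨C, hC, hcard⟩ := hX.exists_encard_le
  refine (finite_and_ncard_le_of_encard_le_ofReal (by positivity)
    (hcard (max R 1) (le_max_right _ _) 0)).1.subset fun p hp => ?_
  rw [Set.mem_ofPred_eq, dist_zero_right]
  exact (mem_pointsIn_zero.1 hp).le.trans (le_max_left _ _)

lemma UniformlyDiscrete.finite_pointsIn (hX : UniformlyDiscrete X) (hv : (crossing v R).Finite) :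
    (pointsIn v R).Finite :=
  (hv.union (hX.finite_pointsIn_zero R)).subset (pointsIn_subset_crossing_union v R)

lemma UniformlyDiscrete.countable (hX : UniformlyDiscrete X) : Countable X := by
  have hcover : (Set.univ : Set X) = ⋃ n : ℕ, pointsIn 0 n := by
    refine (Set.eq_univ_of_forall fun p => ?_).symm
    obtain ⟨n, hn⟩ := exists_nat_gt ‖(p : E d)‖
    exact Set.mem_iUnion.2 ⟨n, mem_pointsIn_zero.2 hn⟩
  rw [← Set.countable_univ_iff, hcover]
  exact Set.countable_iUnion fun n => (hX.finite_pointsIn_zero n).countable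

lemma UniformlyDiscrete.isBigO_ncard_pointsIn_zero (hX : UniformlyDiscrete X) :
    (fun R : ℝ => ((pointsIn (0 : X → E d) R).ncard : ℝ)) =O[atTop] fun R : ℝ => R ^ d := by
  obtain ⟨C, hC, hcard⟩ := hX.exists_encard_le
  refine IsBigO.of_bound C ?_
  filter_upwards [eventually_ge_atTop 1] with R hR
  have hball := finite_and_ncard_le_of_encard_le_ofReal (by positivity) (hcard R hR 0)
  rw [Real.norm_of_nonneg (by positivity), Real.norm_of_nonneg (by positivity)]
  refine le_trans ?_ hball.2
  gcongr
  · exact hball.1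
  · exact fun p hp => (dist_zero_right (p : E d)).trans_le (mem_pointsIn_zero.1 hp).le

lemma isLittleO_add_pow_sub_sub_pow (a c : ℝ) (m : ℕ) :
    (fun R : ℝ => (a * R + c) ^ m - (a * R - c) ^ m) =o[atTop] fun R : ℝ => R ^ m := by
  have hlim : Tendsto (fun R : ℝ => (a + c / R) ^ m - (a - c / R) ^ m) atTop (𝓝 0) := by
    have hc := tendsto_const_nhds (x := c).div_atTop tendsto_id
    simpa using ((hc.const_add a).pow m).sub ((hc.const_sub a).pow m)
  refine isLittleO_of_tendsto' ?_ (hlim.congr' ?_)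
  · filter_upwards [eventually_gt_atTop 0] with R hR h0
    exact absurd h0 (by positivity)
  · filter_upwards [eventually_gt_atTop 0] with R hR
    rw [sub_div, ← div_pow, ← div_pow, add_div, sub_div, mul_div_cancel_right₀ _ hR.ne']

lemma UniformlyDiscrete.finite_shell (hX : UniformlyDiscrete X) (R h : ℝ) :
    (shell X R h).Finite := by
  refine (hX.finite_pointsIn_zero (R + h + 1)).subset fun p hp => mem_pointsIn_zero.2 ?_
  linarith [(mem_shell.1 hp).2]

lemma UniformlyDiscrete.isLittleO_ncard_shell (hX : UniformlyDiscrete X) (hh : 0 ≤ h) :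
    (fun R : ℝ => ((shell X R h).ncard : ℝ)) =o[atTop] fun R : ℝ => R ^ d := by
  obtain ⟨r, hr, hdist⟩ := hX.exists_pairwise_le_dist
  refine IsBigO.trans_isLittleO ?_ (isLittleO_add_pow_sub_sub_pow (2 / r) (2 * h / r + 1) d)
  refine IsBigO.of_bound' ?_
  filter_upwards [eventually_ge_atTop (h + r / 2)] with R hR
  have hcard := encard_le_of_norm_mem_Icc (s := shell X R h) hr hdist
    (a := R - h) (b := R + h) (by linarith) (by linarith) fun p hp =>
      ⟨by linarith [(mem_shell.1 hp).1], by linarith [(mem_shell.1 hp).2]⟩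
  have hinner : 0 ≤ 2 / r * R - (2 * h / r + 1) := by
    have := div_le_div_of_nonneg_right hR (half_pos hr).le
    field_simp at this ⊢
    linarith
  rw [show 2 * (R + h) / r + 1 = 2 / r * R + (2 * h / r + 1) by ring,
    show 2 * (R - h) / r - 1 = 2 / r * R - (2 * h / r + 1) by ring,
    finrank_euclideanSpace_fin] at hcard
  have hdiff : 0 ≤ (2 / r * R + (2 * h / r + 1)) ^ d - (2 / r * R - (2 * h / r + 1)) ^ d := by
    have : 0 ≤ 2 * h / r + 1 := by positivity
    exact sub_nonneg.2 (by gcongr; linarith)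
  rw [Real.norm_of_nonneg (by positivity), Real.norm_of_nonneg hdiff]
  exact (finite_and_ncard_le_of_encard_le_ofReal hdiff hcard).2

lemma isLittleO_comp_nat {u : ℕ → ℝ} {m : ℕ} (hu : u =o[atTop] fun n : ℕ => (n : ℝ) ^ m)
    {a : ℝ → ℕ} (ha : Tendsto a atTop atTop) (hle : ∀ᶠ R in atTop, (a R : ℝ) ≤ 2 * R) :
    (fun R => u (a R)) =o[atTop] fun R : ℝ => R ^ m := by
  refine (hu.comp_tendsto ha).trans_isBigO (IsBigO.pow (IsBigO.of_bound 2 ?_) m)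
  filter_upwards [hle, eventually_ge_atTop 0] with R hR hR0
  rwa [Real.norm_of_nonneg (by positivity), Real.norm_of_nonneg hR0]

lemma isLittleO_comp_floor {u : ℕ → ℝ} {m : ℕ} (hu : u =o[atTop] fun n : ℕ => (n : ℝ) ^ m) :
    (fun R : ℝ => u ⌊R⌋₊) =o[atTop] fun R : ℝ => R ^ m := by
  refine isLittleO_comp_nat hu tendsto_nat_floor_atTop ?_
  filter_upwards [eventually_ge_atTop 0] with R hR
  linarith [Nat.floor_le hR]

lemma isLittleO_comp_floor_add_one {u : ℕ → ℝ} {m : ℕ}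
    (hu : u =o[atTop] fun n : ℕ => (n : ℝ) ^ m) :
    (fun R : ℝ => u (⌊R⌋₊ + 1)) =o[atTop] fun R : ℝ => R ^ m := by
  refine isLittleO_comp_nat hu ((tendsto_add_atTop_nat 1).comp tendsto_nat_floor_atTop) ?_
  filter_upwards [eventually_ge_atTop 1] with R hR
  push_cast
  linarith [Nat.floor_le (zero_le_one.trans hR)]

lemma HasNegligibleCrossing.of_nat (hX : UniformlyDiscrete X)
    (hv : ∀ η > 0, ∀ᶠ n : ℕ in atTop,
      ((crossing v n).encard : ENNReal) ≤ ENNReal.ofReal (η * (n : ℝ) ^ d)) :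
    HasNegligibleCrossing v := by
  have hcard (η : ℝ) (hη : 0 < η) : ∀ᶠ n : ℕ in atTop,
      (crossing v n).Finite ∧ ((crossing v n).ncard : ℝ) ≤ η * (n : ℝ) ^ d :=
    (hv η hη).mono fun n hn => finite_and_ncard_le_of_encard_le_ofReal (by positivity) hn
  have hfin (R : ℝ) : (crossing v R).Finite := by
    obtain ⟨n, ⟨hn, -⟩, hRn⟩ :=
      ((hcard 1 one_pos).and (tendsto_natCast_atTop_atTop.eventually_ge_atTop R)).exists
    have hpts := (hX.finite_pointsIn hn).subset (pointsIn_mono v hRn)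
    exact (hpts.union (hX.finite_pointsIn_zero R)).subset symmDiff_le_sup
  have hnat : (fun n : ℕ => ((crossing v n).ncard : ℝ)) =o[atTop] fun n : ℕ => (n : ℝ) ^ d := by
    refine isLittleO_iff.2 fun η hη => (hcard η hη).mono fun n hn => ?_
    rw [Real.norm_of_nonneg (by positivity), Real.norm_of_nonneg (by positivity)]
    exact hn.2
  refine ⟨hfin, IsBigO.trans_isLittleO (IsBigO.of_bound' ?_) (((isLittleO_comp_floor hnat).add
    (isLittleO_comp_floor_add_one hnat)).add (hX.isLittleO_ncard_shell zero_le_one))⟩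
  filter_upwards [eventually_ge_atTop 0] with R hR
  rw [Real.norm_of_nonneg (by positivity), Real.norm_of_nonneg (by positivity)]
  have hle := (Set.ncard_le_ncard (crossing_subset_floor v hR)
    (((hfin _).union (hfin _)).union (hX.finite_shell R 1))).trans (Set.ncard_union_le _ _)
  exact_mod_cast hle.trans (add_le_add_left (Set.ncard_union_le _ _) _)

end Counting

section Character

lemma norm_character (k x : E d) : ‖character k x‖ = 1 := by
  have hexp : -2 * (Real.pi : ℂ) * Complex.I * ((inner ℝ x k : ℝ) : ℂ)
      = ((-2 * Real.pi * inner ℝ x k : ℝ) : ℂ) * Complex.I := by push_cast; ring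
  rw [character, hexp, Complex.norm_exp_ofReal_mul_I]

lemma character_add (k x y : E d) : character k (x + y) = character k x * character k y := by
  rw [character, character, character, ← Complex.exp_add, inner_add_left]
  push_cast
  ring_nf

lemma continuous_character_left (x : E d) : Continuous fun k : E d => character k x := by
  unfold character
  fun_prop

lemma continuous_character_right (k : E d) : Continuous fun x : E d => character k x := by
  unfold character
  fun_prop

lemma norm_character_sub_le (k l x : E d) :
    ‖character k x - character l x‖ ≤ 2 * Real.pi * (‖x‖ * ‖k - l‖) := by
  have hmul : character k x = character l x * character (k - l) x := by
    rw [character, character, character, ← Complex.exp_add, inner_sub_right]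
    push_cast
    ring_nf
  have hexp : character (k - l) x
      = Complex.exp (Complex.I * ((-(2 * Real.pi * inner ℝ x (k - l)) : ℝ) : ℂ)) := by
    rw [character]
    push_cast
    ring_nf
  rw [hmul, ← mul_sub_one, norm_mul, norm_character, one_mul, hexp]
  refine Real.norm_exp_I_mul_ofReal_sub_one_le.trans ?_
  rw [norm_neg, norm_mul, Real.norm_of_nonneg (by positivity)]
  gcongr
  exact norm_inner_le_norm x (k - l)

end Character

section Finsum

variable {α M : Type*} [SeminormedAddCommGroup M] {s t : Set α} {f : α → M} {C : ℝ}

lemma norm_finsum_mem_le (hs : s.Finite) (hf : ∀ i ∈ s, ‖f i‖ ≤ C) :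
    ‖∑ᶠ i ∈ s, f i‖ ≤ C * s.ncard := by
  rw [finsum_mem_eq_finite_toFinset_sum _ hs, Set.ncard_eq_toFinset_card _ hs, mul_comm,
    ← nsmul_eq_mul, ← Finset.sum_const]
  exact norm_sum_le_of_le _ fun i hi => hf i (hs.mem_toFinset.1 hi)

lemma norm_finsum_mem_sub_finsum_mem_le (hs : s.Finite) (ht : t.Finite)
    (hf : ∀ i ∈ symmDiff s t, ‖f i‖ ≤ C) :
    ‖∑ᶠ i ∈ s, f i - ∑ᶠ i ∈ t, f i‖ ≤ C * (symmDiff s t).ncard := by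
  have hst := hs.sdiff (t := t)
  have hts := ht.sdiff (t := s)
  rw [← finsum_mem_inter_add_sdiff' t (hs.inter_of_left _),
    ← finsum_mem_inter_add_sdiff' (s := t) s (ht.inter_of_left _), Set.inter_comm t s,
    add_sub_add_left_eq_sub, Set.symmDiff_def,
    Set.ncard_union_eq disjoint_sdiff_sdiff hst hts, Nat.cast_add, mul_add]
  exact (norm_sub_le _ _).trans (add_le_add (norm_finsum_mem_le hst fun i hi => hf i (.inl hi))
    (norm_finsum_mem_le hts fun i hi => hf i (.inr hi)))

end Finsum

section ExponentialSums

variable {X : Set (E d)} {v : X → E d} {c e : ℂ} {R : ℝ} {k l : E d}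

/-- The sum over `X ∩ B_R` of the deviations `e^{-2πi⟨p + v p,k⟩} - c e^{-2πi⟨p,k⟩}`. When `v` is
random and `c` is the characteristic function at `k` of the displacement, its terms are centred. -/
noncomputable def fluctuation (v : X → E d) (c : ℂ) (R : ℝ) (k : E d) : ℂ :=
  ∑ᶠ p ∈ pointsIn (0 : X → E d) R, (character k ((p : E d) + v p) - c * character k p)

lemma expSum_eq_finsum (X : Set (E d)) (R : ℝ) (k : E d) :
    expSum X R k = ∑ᶠ p ∈ pointsIn (0 : X → E d) R, character k (p : E d) := by
  have himage : Subtype.val '' pointsIn (0 : X → E d) R = X ∩ Metric.ball 0 R := by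
    ext x
    simp [pointsIn, and_comm]
  rw [expSum, ← himage, finsum_mem_image Subtype.val_injective.injOn]

lemma norm_character_sub_mul_character_le (hc : ‖c‖ ≤ 1) (k x y : E d) :
    ‖character k x - c * character k y‖ ≤ 2 := by
  refine (norm_sub_le _ _).trans ?_
  rw [norm_mul, norm_character, norm_character]
  linarith

lemma norm_fluctuation_le (hX : UniformlyDiscrete X) (v : X → E d) (hc : ‖c‖ ≤ 1) (R : ℝ)
    (k : E d) : ‖fluctuation v c R k‖ ≤ 2 * (pointsIn (0 : X → E d) R).ncard :=
  norm_finsum_mem_le (hX.finite_pointsIn_zero R)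
    fun _ _ => norm_character_sub_mul_character_le hc _ _ _

lemma norm_fluctuation_sub_floor_le (hX : UniformlyDiscrete X) (v : X → E d) (hc : ‖c‖ ≤ 1)
    (hR : 0 ≤ R) (k : E d) :
    ‖fluctuation v c R k - fluctuation v c ⌊R⌋₊ k‖ ≤ 2 * (shell X R 1).ncard := by
  refine (norm_finsum_mem_sub_finsum_mem_le (hX.finite_pointsIn_zero _) (hX.finite_pointsIn_zero _)
    fun _ _ => norm_character_sub_mul_character_le hc _ _ _).trans ?_
  gcongr
  · exact hX.finite_shell R 1
  · intro p hp
    have hfloor := Nat.floor_le hR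
    have hlt := Nat.lt_floor_add_one R
    simp only [Set.mem_symmDiff, mem_pointsIn_zero, not_lt] at hp
    rw [mem_shell]
    rcases hp with hp | hp <;> constructor <;> linarith

lemma norm_perturbedMeanExp_sub_le (hX : UniformlyDiscrete X) (hv : (crossing v R).Finite)
    (c : ℂ) (k : E d) :
    ‖perturbedMeanExp X v R k - c * meanExp X R k‖
      ≤ ((crossing v R).ncard + ‖fluctuation v c R k‖) / volBall d R := by
  set S := ∑ᶠ p ∈ pointsIn v R, character k ((p : E d) + v p)
  set T := ∑ᶠ p ∈ pointsIn (0 : X → E d) R, character k ((p : E d) + v p)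
  have hS : perturbedMeanExp X v R k = ((volBall d R : ℝ) : ℂ)⁻¹ * S := rfl
  have hT : fluctuation v c R k = T - c * expSum X R k := by
    rw [expSum_eq_finsum, mul_finsum_mem,
      ← finsum_mem_sub_distrib _ _ (hX.finite_pointsIn_zero R)]
    rfl
  have hST : ‖S - T‖ ≤ (crossing v R).ncard := by
    rw [← one_mul ((crossing v R).ncard : ℝ)]
    exact norm_finsum_mem_sub_finsum_mem_le (hX.finite_pointsIn hv)
      (hX.finite_pointsIn_zero R) fun p _ => (norm_character k _).le
  have hsplit : perturbedMeanExp X v R k - c * meanExp X R k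
      = (S - T + fluctuation v c R k) / (volBall d R : ℝ) := by
    rw [hS, hT, meanExp]
    ring
  have hvol : 0 ≤ volBall d R := measureReal_nonneg
  rw [hsplit, norm_div, Complex.norm_of_nonneg hvol]
  gcongr
  exact (norm_add_le _ _).trans (by gcongr)

lemma isBigO_pow_volBall (d : ℕ) : (fun R : ℝ => R ^ d) =O[atTop] volBall d := by
  have hunit : 0 < volBall d 1 :=
    ENNReal.toReal_pos (Metric.measure_ball_pos _ _ one_pos).ne' measure_ball_lt_top.ne
  refine IsBigO.of_bound (volBall d 1)⁻¹ ?_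
  filter_upwards [eventually_gt_atTop 0] with R hR
  have hscale : volBall d R = R ^ d * volBall d 1 := by
    rw [volBall, measureReal_def, Measure.addHaar_ball_of_pos _ _ hR, ENNReal.toReal_mul,
      ENNReal.toReal_ofReal (by positivity), finrank_euclideanSpace_fin]
    rfl
  rw [hscale, norm_mul, Real.norm_of_nonneg hunit.le]
  field_simp
  rfl

lemma isLittleO_fluctuation (hX : UniformlyDiscrete X) (hc : ‖c‖ ≤ 1)
    (hF : (fun n : ℕ => fluctuation v c n k) =o[atTop] fun n : ℕ => (n : ℝ) ^ d) :
    (fun R : ℝ => fluctuation v c R k) =o[atTop] fun R : ℝ => R ^ d := by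
  have hfloor : (fun R : ℝ => fluctuation v c R k - fluctuation v c ⌊R⌋₊ k)
      =o[atTop] fun R : ℝ => R ^ d := by
    refine IsBigO.trans_isLittleO (IsBigO.of_bound 2 ?_) (hX.isLittleO_ncard_shell zero_le_one)
    filter_upwards [eventually_ge_atTop 0] with R hR
    rw [RCLike.norm_natCast]
    exact norm_fluctuation_sub_floor_le hX v hc hR k
  have hnat : (fun R : ℝ => fluctuation v c ⌊R⌋₊ k) =o[atTop] fun R : ℝ => R ^ d :=
    (isLittleO_comp_floor hF.norm_left).of_norm_left
  simpa using hfloor.add hnat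

theorem HasNegligibleCrossing.tendsto_perturbedMeanExp_sub (hX : UniformlyDiscrete X)
    (hv : HasNegligibleCrossing v) (hc : ‖c‖ ≤ 1)
    (hF : (fun n : ℕ => fluctuation v c n k) =o[atTop] fun n : ℕ => (n : ℝ) ^ d) :
    Tendsto (fun R : ℝ => perturbedMeanExp X v R k - c * meanExp X R k) atTop (𝓝 0) :=
  squeeze_zero_norm (fun R => norm_perturbedMeanExp_sub_le hX (hv.1 R) c k)
    ((hv.2.add (isLittleO_fluctuation hX hc hF).norm_left).trans_isBigO
      (isBigO_pow_volBall d)).tendsto_div_nhds_zero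

lemma HasNegligibleCrossing.exists_norm_perturbedMeanExp_sub_le (hX : UniformlyDiscrete X)
    (hv : HasNegligibleCrossing v) :
    ∃ C : ℝ, ∀ᶠ R in atTop, ∀ (c : ℂ) (k : E d), ‖c‖ ≤ 1 →
      ‖perturbedMeanExp X v R k - c * meanExp X R k‖ ≤ C := by
  obtain ⟨C, hC, hbound⟩ := ((hv.2.isBigO.add
    (hX.isBigO_ncard_pointsIn_zero.const_mul_left 2)).trans (isBigO_pow_volBall d)).exists_nonneg
  refine ⟨C, hbound.bound.mono fun R hR c k hc => ?_⟩
  have hvol : 0 ≤ volBall d R := measureReal_nonneg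
  rw [Real.norm_of_nonneg (by positivity), Real.norm_of_nonneg hvol] at hR
  refine (norm_perturbedMeanExp_sub_le hX (hv.1 R) c k).trans
    (div_le_of_le_mul₀ hvol hC (le_trans ?_ hR))
  gcongr
  exact norm_fluctuation_le hX v hc R k

lemma continuous_meanExp (hX : UniformlyDiscrete X) (R : ℝ) : Continuous (meanExp X R) := by
  simp only [funext (expSum_eq_finsum X R), funext fun k => meanExp.eq_1 X R k,
    finsum_mem_eq_finite_toFinset_sum _ (hX.finite_pointsIn_zero R)]
  exact continuous_const.mul (continuous_finsetSum _ fun p _ => continuous_character_left _)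

lemma continuous_perturbedMeanExp (hv : (pointsIn v R).Finite) :
    Continuous (perturbedMeanExp X v R) := by
  have hsum (k : E d) : perturbedMeanExp X v R k = ((volBall d R : ℝ) : ℂ)⁻¹ *
      ∑ p ∈ hv.toFinset, character k ((p : E d) + v p) := by
    rw [← finsum_mem_eq_finite_toFinset_sum _ hv]
    rfl
  rw [funext hsum]
  exact continuous_const.mul (continuous_finsetSum _ fun p _ => continuous_character_left _)

theorem HasNegligibleCrossing.tendsto_integral_mul_perturbedMeanExp_sub
    (hX : UniformlyDiscrete X) (hv : HasNegligibleCrossing v) {φ : E d → ℂ} (hφc : Continuous φ)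
    (hφ : ∀ k, ‖φ k‖ ≤ 1)
    (hlim : ∀ k, Tendsto (fun R : ℝ => perturbedMeanExp X v R k - φ k * meanExp X R k)
      atTop (𝓝 0))
    {f : E d → ℂ} (hf : Continuous f) (hfs : HasCompactSupport f) :
    Tendsto (fun R : ℝ => ∫ k, f k * (perturbedMeanExp X v R k - φ k * meanExp X R k))
      atTop (𝓝 0) := by
  obtain ⟨C, hC⟩ := hv.exists_norm_perturbedMeanExp_sub_le hX
  have hcont (R : ℝ) :
      Continuous fun k => f k * (perturbedMeanExp X v R k - φ k * meanExp X R k) :=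
    hf.mul ((continuous_perturbedMeanExp (hX.finite_pointsIn (hv.1 R))).sub
      (hφc.mul (continuous_meanExp hX R)))
  rw [← integral_zero (E d) ℂ]
  refine tendsto_integral_filter_of_dominated_convergence (fun k => ‖f k‖ * C)
    (.of_forall fun R => (hcont R).aestronglyMeasurable) ?_
    ((hf.norm.integrable_of_hasCompactSupport hfs.norm).mul_const C)
    (.of_forall fun k => by simpa using (hlim k).const_mul (f k))
  filter_upwards [hC] with R hR
  refine .of_forall fun k => ?_
  rw [norm_mul]
  gcongr
  exact hR (φ k) k (hφ k)

lemma norm_character_sub_mul_character_sub_le {x y : E d} (hc : ‖c‖ ≤ 1) (hx : ‖x‖ ≤ R)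
    (hy : ‖y‖ ≤ R) (k l : E d) :
    ‖character k x - c * character k y - (character l x - e * character l y)‖
      ≤ 4 * Real.pi * (R * ‖k - l‖) + ‖c - e‖ := by
  have hsplit : character k x - c * character k y - (character l x - e * character l y)
      = (character k x - character l x)
        - (c * (character k y - character l y) + (c - e) * character l y) := by ring
  have hx' : ‖character k x - character l x‖ ≤ 2 * Real.pi * (R * ‖k - l‖) :=
    (norm_character_sub_le k l x).trans (by gcongr)
  have hy' : ‖c * (character k y - character l y)‖ ≤ 2 * Real.pi * (R * ‖k - l‖) := by
    rw [norm_mul]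
    exact (mul_le_of_le_one_left (norm_nonneg _) hc).trans
      ((norm_character_sub_le k l y).trans (by gcongr))
  have hce : ‖(c - e) * character l y‖ = ‖c - e‖ := by rw [norm_mul, norm_character, mul_one]
  rw [hsplit]
  linarith [norm_sub_le (character k x - character l x)
    (c * (character k y - character l y) + (c - e) * character l y),
    norm_add_le (c * (character k y - character l y)) ((c - e) * character l y)]

lemma norm_fluctuation_sub_le (hX : UniformlyDiscrete X) (hv : (crossing v R).Finite)
    (hR : 0 ≤ R) (hc : ‖c‖ ≤ 1) (he : ‖e‖ ≤ 1) (k l : E d) :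
    ‖fluctuation v c R k - fluctuation v e R l‖ ≤ 4 * (crossing v R).ncard +
      (4 * Real.pi * (R * ‖k - l‖) + ‖c - e‖) * (pointsIn (0 : X → E d) R).ncard := by
  have hB := hX.finite_pointsIn_zero R
  rw [fluctuation, fluctuation, ← finsum_mem_sub_distrib _ _ hB,
    ← finsum_mem_inter_add_sdiff' (crossing v R) (hB.inter_of_left _)]
  refine (norm_add_le _ _).trans (add_le_add ?_ ?_)
  · refine (norm_finsum_mem_le (C := 4) (hB.inter_of_left _) fun p _ => ?_).trans (by
      gcongr
      exacts [Set.inter_subset_right])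
    linarith [norm_sub_le (character k ((p : E d) + v p) - c * character k p)
      (character l ((p : E d) + v p) - e * character l p),
      norm_character_sub_mul_character_le hc k ((p : E d) + v p) p,
      norm_character_sub_mul_character_le he l ((p : E d) + v p) p]
  · refine (norm_finsum_mem_le hB.sdiff fun p ⟨hp, hpc⟩ =>
      norm_character_sub_mul_character_sub_le hc ?_ (mem_pointsIn_zero.1 hp).le k l).trans (by
        gcongr
        exacts [Set.sdiff_subset])
    rw [mem_crossing, not_or, not_and, not_and, not_le, not_le] at hpc
    exact (hpc.2 (mem_pointsIn_zero.1 hp)).le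

lemma exists_tendsto_of_net {N : ℕ → Finset (E d)}
    (hN : ∀ (n : ℕ) (k : E d), ‖k‖ ≤ n → ∃ z ∈ N n, dist k z ≤ 1 / ((n : ℝ) + 1) ^ 2) (k : E d) :
    ∃ z : ℕ → E d, (∀ᶠ n in atTop, z n ∈ N n) ∧ Tendsto z atTop (𝓝 k) ∧
      Tendsto (fun n : ℕ => n * ‖k - z n‖) atTop (𝓝 0) := by
  have hk : ∀ᶠ n : ℕ in atTop, ‖k‖ ≤ n := tendsto_natCast_atTop_atTop.eventually_ge_atTop _
  have hnet (n : ℕ) : ∃ z : E d, ‖k‖ ≤ n → z ∈ N n ∧ ‖k - z‖ ≤ 1 / ((n : ℝ) + 1) ^ 2 := by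
    by_cases h : ‖k‖ ≤ n
    · obtain ⟨z, hz, hkz⟩ := hN n k h
      exact ⟨z, fun _ => ⟨hz, (dist_eq_norm k z).symm.trans_le hkz⟩⟩
    · exact ⟨k, fun h' => absurd h' h⟩
  choose z hz using hnet
  have hzero : Tendsto (fun n : ℕ => 1 / ((n : ℝ) + 1)) atTop (𝓝 0) :=
    tendsto_one_div_add_atTop_nhds_zero_nat
  refine ⟨z, hk.mono fun n hn => (hz n hn).1, ?_, ?_⟩
  · rw [tendsto_iff_norm_sub_tendsto_zero]
    refine squeeze_zero' (.of_forall fun n => norm_nonneg _)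
      (hk.mono fun n hn => (norm_sub_rev _ _).trans_le (hz n hn).2) ?_
    simpa using hzero.pow 2
  · refine squeeze_zero' (.of_forall fun n => by positivity) (hk.mono fun n hn => ?_) hzero
    calc n * ‖k - z n‖ ≤ ((n : ℝ) + 1) * (1 / ((n : ℝ) + 1) ^ 2) := by
          gcongr
          · linarith
          · exact (hz n hn).2
      _ = 1 / ((n : ℝ) + 1) := by field_simp

lemma isLittleO_fluctuation_of_net (hX : UniformlyDiscrete X) (hv : HasNegligibleCrossing v)
    {φ : E d → ℂ} (hφc : Continuous φ) (hφ : ∀ k, ‖φ k‖ ≤ 1) {N : ℕ → Finset (E d)}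
    (hN : ∀ (n : ℕ) (k : E d), ‖k‖ ≤ n → ∃ z ∈ N n, dist k z ≤ 1 / ((n : ℝ) + 1) ^ 2)
    (hF : ∀ η > 0, ∀ᶠ n : ℕ in atTop, ∀ z ∈ N n, ‖fluctuation v (φ z) n z‖ ≤ η * (n : ℝ) ^ d)
    (k : E d) : (fun n : ℕ => fluctuation v (φ k) n k) =o[atTop] fun n : ℕ => (n : ℝ) ^ d := by
  obtain ⟨z, hz, hzk, hdist⟩ := exists_tendsto_of_net hN k
  have hcoef : Tendsto (fun n : ℕ => 4 * Real.pi * (n * ‖k - z n‖) + ‖φ k - φ (z n)‖)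
      atTop (𝓝 0) := by
    simpa using (hdist.const_mul (4 * Real.pi)).add
      (((hφc.tendsto k).comp hzk).const_sub (φ k)).norm
  have hbound : (fun n : ℕ => 4 * ((crossing v n).ncard : ℝ) +
      (4 * Real.pi * (n * ‖k - z n‖) + ‖φ k - φ (z n)‖) * (pointsIn (0 : X → E d) n).ncard)
      =o[atTop] fun n : ℕ => (n : ℝ) ^ d := by
    have hcount := ((isLittleO_one_iff ℝ).2 hcoef).mul_isBigO
      (hX.isBigO_ncard_pointsIn_zero.comp_tendsto tendsto_natCast_atTop_atTop)
    simp only [one_mul] at hcount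
    exact ((hv.2.comp_tendsto tendsto_natCast_atTop_atTop).const_mul_left 4).add hcount
  have hdiff : (fun n : ℕ => fluctuation v (φ k) n k - fluctuation v (φ (z n)) n (z n))
      =o[atTop] fun n : ℕ => (n : ℝ) ^ d := by
    refine IsBigO.trans_isLittleO (IsBigO.of_norm_le fun n => ?_) hbound
    exact norm_fluctuation_sub_le hX (hv.1 n) n.cast_nonneg (hφ k) (hφ (z n)) k (z n)
  have hgrid : (fun n : ℕ => fluctuation v (φ (z n)) n (z n)) =o[atTop] fun n : ℕ => (n : ℝ) ^ d :=
    isLittleO_iff.2 fun η hη => ((hF η hη).and hz).mono fun n ⟨hn, hzn⟩ => by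
      rw [Real.norm_of_nonneg (by positivity)]
      exact hn (z n) hzn
  simpa using hdiff.add hgrid

end ExponentialSums

section Concentration

open scoped ENNReal

variable {Ω ι : Type*} [MeasurableSpace Ω] {P : Measure Ω}

lemma mgf_one_le_of_mem_Icc [IsProbabilityMeasure P] {Y : Ω → ℝ} (hYm : AEMeasurable Y P)
    (hY : ∀ ω, Y ω ∈ Set.Icc 0 1) : mgf Y P 1 ≤ Real.exp ((Real.exp 1 - 1) * ∫ ω, Y ω ∂P) := by
  have hint : Integrable Y P := .of_mem_Icc 0 1 hYm (.of_forall hY)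
  have hsecant (ω : Ω) : Real.exp (Y ω) ≤ 1 + (Real.exp 1 - 1) * Y ω := by
    have hconv := convexOn_exp.2 (Set.mem_univ 0) (Set.mem_univ 1)
      (sub_nonneg.2 (hY ω).2) (hY ω).1 (sub_add_cancel 1 (Y ω))
    simp only [smul_eq_mul, mul_zero, mul_one, zero_add, Real.exp_zero] at hconv
    linarith
  calc mgf Y P 1 ≤ ∫ ω, 1 + (Real.exp 1 - 1) * Y ω ∂P := by
        simp only [mgf, one_mul]
        exact integral_mono_of_nonneg (.of_forall fun ω => Real.exp_nonneg _)
          ((integrable_const 1).add (hint.const_mul _)) (.of_forall hsecant)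
    _ = (Real.exp 1 - 1) * ∫ ω, Y ω ∂P + 1 := by
        rw [integral_add (integrable_const 1) (hint.const_mul _), integral_const_mul]
        simp [add_comm]
    _ ≤ _ := Real.add_one_le_exp _

lemma measureReal_le_sum_le_exp {Y : ι → Ω → ℝ} (hindep : iIndepFun Y P)
    (hYm : ∀ i, AEMeasurable (Y i) P) (hY : ∀ i ω, Y i ω ∈ Set.Icc 0 1) (s : Finset ι) (t : ℝ) :
    P.real {ω | t ≤ ∑ i ∈ s, Y i ω}
      ≤ Real.exp ((Real.exp 1 - 1) * ∑ i ∈ s, ∫ ω, Y i ω ∂P - t) := by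
  have := hindep.isProbabilityMeasure
  have hsum : ∀ ω, (∑ i ∈ s, Y i) ω ∈ Set.Icc (0 : ℝ) s.card := fun ω => by
    rw [Finset.sum_apply, ← nsmul_one, ← Finset.sum_const]
    exact ⟨Finset.sum_nonneg fun i _ => (hY i ω).1, Finset.sum_le_sum fun i _ => (hY i ω).2⟩
  have hexp : Integrable (fun ω => Real.exp (1 * (∑ i ∈ s, Y i) ω)) P :=
    integrable_exp_mul_of_mem_Icc (s.aemeasurable_sum fun i _ => hYm i) (.of_forall hsum)
  calc P.real {ω | t ≤ ∑ i ∈ s, Y i ω} = P.real {ω | t ≤ (∑ i ∈ s, Y i) ω} := by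
        simp only [Finset.sum_apply]
    _ ≤ Real.exp (-1 * t) * mgf (∑ i ∈ s, Y i) P 1 := measure_ge_le_exp_mul_mgf t zero_le_one hexp
    _ = Real.exp (-t) * ∏ i ∈ s, mgf (Y i) P 1 := by rw [hindep.mgf_sum₀ hYm, neg_one_mul]
    _ ≤ Real.exp (-t) * ∏ i ∈ s, Real.exp ((Real.exp 1 - 1) * ∫ ω, Y i ω ∂P) := by
        gcongr with i
        · exact fun i _ => mgf_nonneg
        · exact mgf_one_le_of_mem_Icc (hYm i) (hY i)
    _ = _ := by rw [← Real.exp_sum, ← Real.exp_add, ← Finset.mul_sum, neg_add_eq_sub]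

lemma measure_lt_tsum_le_exp [Countable ι] {Y : ι → Ω → ℝ} (hindep : iIndepFun Y P)
    (hYm : ∀ i, AEMeasurable (Y i) P) (hY : ∀ i ω, Y i ω ∈ Set.Icc 0 1) {m : ℝ} (hm : 0 ≤ m)
    (hsum : ∑' i, ENNReal.ofReal (∫ ω, Y i ω ∂P) ≤ ENNReal.ofReal m) (t : ℝ) :
    P {ω | ENNReal.ofReal t < ∑' i, ENNReal.ofReal (Y i ω)}
      ≤ ENNReal.ofReal (Real.exp ((Real.exp 1 - 1) * m - t)) := by
  have := hindep.isProbabilityMeasure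
  have hfinite (s : Finset ι) : P {ω | t ≤ ∑ i ∈ s, Y i ω}
      ≤ ENNReal.ofReal (Real.exp ((Real.exp 1 - 1) * m - t)) := by
    have hms : ∑ i ∈ s, ∫ ω, Y i ω ∂P ≤ m := by
      rw [← ENNReal.ofReal_le_ofReal_iff hm,
        ENNReal.ofReal_sum_of_nonneg fun i _ => integral_nonneg fun ω => (hY i ω).1]
      exact (ENNReal.sum_le_tsum s).trans hsum
    rw [← ofReal_measureReal]
    refine ENNReal.ofReal_le_ofReal ((measureReal_le_sum_le_exp hindep hYm hY s t).trans ?_)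
    gcongr
    linarith [Real.add_one_le_exp 1]
  have hcover : {ω | ENNReal.ofReal t < ∑' i, ENNReal.ofReal (Y i ω)}
      ⊆ ⋃ s : Finset ι, {ω | t ≤ ∑ i ∈ s, Y i ω} := by
    intro ω hω
    rw [Set.mem_ofPred_eq, ENNReal.tsum_eq_iSup_sum, lt_iSup_iff] at hω
    obtain ⟨s, hs⟩ := hω
    rw [← ENNReal.ofReal_sum_of_nonneg fun i _ => (hY i ω).1, ENNReal.ofReal_lt_ofReal_iff'] at hs
    exact Set.mem_iUnion.2 ⟨s, hs.1.le⟩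
  have hmono : Monotone fun s : Finset ι => {ω | t ≤ ∑ i ∈ s, Y i ω} := fun s s' hss ω hω =>
    hω.trans (Finset.sum_le_sum_of_subset_of_nonneg hss fun i _ _ => (hY i ω).1)
  refine (measure_mono hcover).trans ?_
  rw [hmono.directed_le.measure_iUnion]
  exact iSup_le hfinite

lemma encard_setOf_mem_eq_tsum {α : Type*} (S : ι → Set α) (x : α) :
    ({i | x ∈ S i}.encard : ℝ≥0∞) = ∑' i, (S i).indicator 1 x := by
  rw [← ENNReal.tsum_set_one]
  exact tsum_subtype {i | x ∈ S i} fun _ => 1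

variable {α : Type*} [MeasurableSpace α] {S : ι → Set α}

lemma measurable_encard_setOf_mem [Countable ι] (hS : ∀ i, MeasurableSet (S i)) :
    Measurable fun x => ({i | x ∈ S i}.encard : ℝ≥0∞) := by
  simp only [encard_setOf_mem_eq_tsum]
  exact .tsum fun i => measurable_one.indicator (hS i)

lemma lintegral_encard_setOf_mem [Countable ι] (μ : Measure α) (hS : ∀ i, MeasurableSet (S i)) :
    ∫⁻ x, ({i | x ∈ S i}.encard : ℝ≥0∞) ∂μ = ∑' i, μ (S i) := by
  simp only [encard_setOf_mem_eq_tsum]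
  rw [lintegral_tsum fun i => (measurable_one.indicator (hS i)).aemeasurable]
  simp only [lintegral_indicator_one (hS _)]

lemma measure_lt_encard_le_exp [Countable ι] {ξ : ι → Ω → α} (hindep : iIndepFun ξ P)
    (hξ : ∀ i, AEMeasurable (ξ i) P) (hS : ∀ i, MeasurableSet (S i)) {m : ℝ} (hm : 0 ≤ m)
    (hsum : ∑' i, P.map (ξ i) (S i) ≤ ENNReal.ofReal m) (t : ℝ) :
    P {ω | ENNReal.ofReal t < ({i | ξ i ω ∈ S i}.encard : ℝ≥0∞)}
      ≤ ENNReal.ofReal (Real.exp ((Real.exp 1 - 1) * m - t)) := by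
  have := hindep.isProbabilityMeasure
  have hmeas (i : ι) : Measurable ((S i).indicator (1 : α → ℝ)) := measurable_one.indicator (hS i)
  have hmean (i : ι) :
      ENNReal.ofReal (∫ ω, (S i).indicator (1 : α → ℝ) (ξ i ω) ∂P) = P.map (ξ i) (S i) := by
    have := Measure.isProbabilityMeasure_map (hξ i)
    rw [← integral_map (hξ i) (hmeas i).aestronglyMeasurable, integral_indicator_one (hS i),
      ofReal_measureReal]
  have hcount (ω : Ω) : ({i | ξ i ω ∈ S i}.encard : ℝ≥0∞)
      = ∑' i, ENNReal.ofReal ((S i).indicator (1 : α → ℝ) (ξ i ω)) := by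
    refine (encard_setOf_mem_eq_tsum (fun i => ξ i ⁻¹' S i) ω).trans (tsum_congr fun i => ?_)
    by_cases hi : ξ i ω ∈ S i <;> simp [hi]
  simp only [hcount]
  simp only [← hmean] at hsum
  exact measure_lt_tsum_le_exp (hindep.comp _ hmeas) (fun i => (hmeas i).comp_aemeasurable (hξ i))
    (fun i ω => ⟨Set.indicator_nonneg (fun _ _ => zero_le_one) _,
      Set.indicator_le_self' (fun _ _ => zero_le_one) _⟩) hm hsum t

lemma exists_half_le_re_mul {z : ℂ} {t : ℝ} (hz : t ≤ ‖z‖) :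
    ∃ u ∈ ({1, -1, Complex.I, -Complex.I} : Finset ℂ), t / 2 ≤ (u * z).re := by
  have hsum := hz.trans (Complex.norm_le_abs_re_add_abs_im z)
  rcases le_total |z.im| |z.re| with h | h
  · rcases le_abs.1 (show t / 2 ≤ |z.re| by linarith) with hre | hre
    · exact ⟨1, by simp, by simpa using hre⟩
    · exact ⟨-1, by simp, by simpa using hre⟩
  · rcases le_abs.1 (show t / 2 ≤ |z.im| by linarith) with him | him
    · exact ⟨-Complex.I, by simp, by simpa using him⟩
    · exact ⟨Complex.I, by simp, by simpa using him⟩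

variable {Z : ι → Ω → ℂ} {b t : ℝ} {s : Finset ι}

lemma measureReal_le_sum_re_mul_le_exp (hindep : iIndepFun Z P)
    (hZm : ∀ i ∈ s, AEMeasurable (Z i) P) (hb : ∀ i ∈ s, ∀ ω, ‖Z i ω‖ ≤ b)
    (hmean : ∀ i ∈ s, ∫ ω, Z i ω ∂P = 0) (ht : 0 ≤ t) {u : ℂ} (hu : ‖u‖ = 1) :
    P.real {ω | t ≤ ∑ i ∈ s, (u * Z i ω).re} ≤ Real.exp (-t ^ 2 / (2 * (s.card * b ^ 2))) := by
  have := hindep.isProbabilityMeasure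
  have hindep_re : iIndepFun (fun i ω => (u * Z i ω).re) P :=
    hindep.comp (fun _ z => (u * z).re) fun _ => by fun_prop
  have hsub : ∀ i ∈ s, HasSubgaussianMGF (fun ω => (u * Z i ω).re) ((‖b - (-b)‖₊ / 2) ^ 2) P := by
    intro i hi
    refine hasSubgaussianMGF_of_mem_Icc_of_integral_eq_zero ?_ (.of_forall fun ω => ?_) ?_
    · have := hZm i hi
      fun_prop
    · rw [Set.mem_Icc, ← abs_le]
      refine (Complex.abs_re_le_norm _).trans ?_
      rw [norm_mul, hu, one_mul]
      exact hb i hi ω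
    · have hint : Integrable (Z i) P :=
        .of_bound (hZm i hi).aestronglyMeasurable b (.of_forall (hb i hi))
      refine (integral_re (hint.const_mul u)).trans ?_
      rw [integral_const_mul, hmean i hi, mul_zero]
      rfl
  have hvar : (((‖b - (-b)‖₊ / 2) ^ 2 : NNReal) : ℝ) = b ^ 2 := by
    rw [sub_neg_eq_add, ← two_mul, NNReal.coe_pow, NNReal.coe_div, coe_nnnorm, norm_mul]
    simp
  refine (HasSubgaussianMGF.measure_sum_ge_le_of_iIndepFun hindep_re hsub ht).trans_eq ?_
  rw [Finset.sum_const, NNReal.coe_nsmul, hvar, nsmul_eq_mul]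

lemma measureReal_le_norm_sum_le_exp (hindep : iIndepFun Z P)
    (hZm : ∀ i ∈ s, AEMeasurable (Z i) P) (hb : ∀ i ∈ s, ∀ ω, ‖Z i ω‖ ≤ b)
    (hmean : ∀ i ∈ s, ∫ ω, Z i ω ∂P = 0) (ht : 0 ≤ t) :
    P.real {ω | t ≤ ‖∑ i ∈ s, Z i ω‖} ≤ 4 * Real.exp (-t ^ 2 / (8 * (s.card * b ^ 2))) := by
  have := hindep.isProbabilityMeasure
  let U : Finset ℂ := {1, -1, Complex.I, -Complex.I}
  have hU : ∀ u ∈ U, ‖u‖ = 1 := by simp [U]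
  have hdir : ∀ u ∈ U, P.real {ω | t / 2 ≤ ∑ i ∈ s, (u * Z i ω).re}
      ≤ Real.exp (-t ^ 2 / (8 * (s.card * b ^ 2))) := by
    intro u hu
    refine (measureReal_le_sum_re_mul_le_exp hindep hZm hb hmean (div_nonneg ht zero_le_two)
      (hU u hu)).trans_eq ?_
    ring_nf
  calc P.real {ω | t ≤ ‖∑ i ∈ s, Z i ω‖}
      ≤ P.real (⋃ u ∈ U, {ω | t / 2 ≤ ∑ i ∈ s, (u * Z i ω).re}) := by
        refine measureReal_mono (fun ω hω => ?_) (measure_ne_top _ _)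
        obtain ⟨u, hu, hre⟩ := exists_half_le_re_mul hω
        refine Set.mem_biUnion hu ?_
        rwa [Finset.mul_sum, Complex.re_sum] at hre
    _ ≤ ∑ u ∈ U, P.real {ω | t / 2 ≤ ∑ i ∈ s, (u * Z i ω).re} := measureReal_biUnion_finset_le _ _
    _ ≤ U.card • Real.exp (-t ^ 2 / (8 * (s.card * b ^ 2))) := Finset.sum_le_card_nsmul _ _ _ hdir
    _ ≤ _ := by
        rw [nsmul_eq_mul]
        gcongr
        exact_mod_cast Finset.card_le_four

lemma ae_eventually_notMem_of_isBigO_exp [IsFiniteMeasure P] {A : ℕ → Set Ω} {c : ℝ} (hc : 0 < c)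
    (m : ℕ) (hA : (fun n => P.real (A n)) =O[atTop] fun n : ℕ => (n : ℝ) ^ m * Real.exp (-c * n)) :
    ∀ᵐ ω ∂P, ∀ᶠ n in atTop, ω ∉ A n := by
  have hsum : Summable fun n => P.real (A n) :=
    summable_of_isBigO_nat (Real.summable_pow_mul_exp_neg_nat_mul m hc) hA
  refine ae_eventually_notMem ?_
  simpa using hsum.tsum_ofReal_ne_top

lemma ae_forall_pos {p : ℝ → Ω → Prop} (hp : ∀ η > 0, ∀ᵐ ω ∂P, p η ω)
    (hmono : ∀ ω η η', η ≤ η' → p η ω → p η' ω) : ∀ᵐ ω ∂P, ∀ η > 0, p η ω := by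
  have hall : ∀ᵐ ω ∂P, ∀ m : ℕ, p (1 / ((m : ℝ) + 1)) ω :=
    ae_all_iff.2 fun m => hp _ Nat.one_div_pos_of_nat
  filter_upwards [hall] with ω hω η hη
  obtain ⟨m, hm⟩ := exists_nat_one_div_lt hη
  exact hmono ω _ _ hm.le (hω m)

end Concentration

section CharacteristicFunction

variable (ν : Measure (E d)) [IsProbabilityMeasure ν]

lemma integrable_character (k : E d) : Integrable (character k) ν :=
  .of_bound (continuous_character_right k).aestronglyMeasurable 1
    (.of_forall fun x => (norm_character k x).le)

lemma norm_integral_character_le (k : E d) : ‖∫ x, character k x ∂ν‖ ≤ 1 := by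
  refine (norm_integral_le_integral_norm _).trans_eq ?_
  simp only [norm_character, integral_const, probReal_univ, smul_eq_mul, mul_one]

lemma continuous_integral_character : Continuous fun k : E d => ∫ x, character k x ∂ν :=
  continuous_of_dominated (fun k => (continuous_character_right k).aestronglyMeasurable)
    (fun k => .of_forall fun x => (norm_character k x).le) (integrable_const 1)
    (.of_forall continuous_character_left)

end CharacteristicFunction

section MeanCrossing

variable {X : Set (E d)} {R : ℝ}

lemma encard_crossing_const_le (hX : UniformlyDiscrete X) :
    ∃ C : ℝ, 0 ≤ C ∧ ∀ R : ℝ, 1 ≤ R → ∀ x : E d,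
      ((crossing (fun _ : X => x) R).encard : ENNReal) ≤ ENNReal.ofReal (C * R ^ d) := by
  obtain ⟨C, hC, hcard⟩ := hX.exists_encard_le
  refine ⟨2 * C, by positivity, fun R hR x => ?_⟩
  have hsub : crossing (fun _ : X => x) R
      ⊆ {p : X | dist (p : E d) (-x) ≤ R} ∪ {p : X | dist (p : E d) 0 ≤ R} := by
    intro p hp
    simp only [Set.mem_union, Set.mem_ofPred_eq, dist_eq_norm, sub_neg_eq_add, sub_zero]
    exact (mem_crossing.1 hp).imp (fun h => h.1.le) fun h => h.1.le
  have hunion := (Set.encard_le_encard hsub).trans (Set.encard_union_le _ _)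
  calc ((crossing (fun _ : X => x) R).encard : ENNReal)
      ≤ ({p : X | dist (p : E d) (-x) ≤ R}.encard : ENNReal)
        + ({p : X | dist (p : E d) 0 ≤ R}.encard : ENNReal) := by exact_mod_cast hunion
    _ ≤ ENNReal.ofReal (C * R ^ d) + ENNReal.ofReal (C * R ^ d) :=
        add_le_add (hcard R hR _) (hcard R hR _)
    _ = ENNReal.ofReal (2 * C * R ^ d) := by
        rw [← ENNReal.ofReal_add (by positivity) (by positivity)]
        ring_nf

lemma tendsto_encard_crossing_const_div (hX : UniformlyDiscrete X) (x : E d) :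
    Tendsto (fun R : ℝ => ((crossing (fun _ : X => x) R).encard : ENNReal) / ENNReal.ofReal (R ^ d))
      atTop (𝓝 0) := by
  have hshell : Tendsto (fun R : ℝ => ENNReal.ofReal ((shell X R ‖x‖).ncard / R ^ d))
      atTop (𝓝 0) := by
    simpa using ENNReal.tendsto_ofReal
      (hX.isLittleO_ncard_shell (norm_nonneg x)).tendsto_div_nhds_zero
  refine tendsto_of_tendsto_of_tendsto_of_le_of_le' tendsto_const_nhds hshell
    (.of_forall fun R => zero_le) ?_
  filter_upwards [eventually_gt_atTop 0] with R hR
  rw [ENNReal.ofReal_div_of_pos (by positivity), ENNReal.ofReal_natCast]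
  gcongr
  have hle := Set.encard_le_encard (crossing_subset_shell (X := X) x R)
  rw [← (hX.finite_shell R ‖x‖).cast_ncard_eq] at hle
  exact_mod_cast hle

lemma measurableSet_setOf_mem_crossing (p : X) (R : ℝ) :
    MeasurableSet {x : E d | p ∈ crossing (fun _ => x) R} := by
  simp only [mem_crossing]
  measurability

lemma eventually_lintegral_encard_crossing_le (hX : UniformlyDiscrete X) (ν : Measure (E d))
    [IsFiniteMeasure ν] {η : ℝ} (hη : 0 < η) :
    ∀ᶠ R : ℝ in atTop, ∫⁻ x, ((crossing (fun _ : X => x) R).encard : ENNReal) ∂ν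
      ≤ ENNReal.ofReal (η * R ^ d) := by
  have := hX.countable
  have hmeas (R : ℝ) :
      Measurable fun x : E d => ((crossing (fun _ : X => x) R).encard : ENNReal) :=
    measurable_encard_setOf_mem fun p => measurableSet_setOf_mem_crossing p R
  obtain ⟨C, hC, hcard⟩ := encard_crossing_const_le hX
  have hlim : Tendsto (fun R : ℝ => ∫⁻ x,
      ((crossing (fun _ : X => x) R).encard : ENNReal) / ENNReal.ofReal (R ^ d) ∂ν)
      atTop (𝓝 0) := by
    rw [← lintegral_zero (μ := ν)]
    refine tendsto_lintegral_filter_of_dominated_convergence (fun _ => ENNReal.ofReal C)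
      (.of_forall fun R => (hmeas R).div_const _) ?_ ?_
      (.of_forall fun x => tendsto_encard_crossing_const_div hX x)
    · filter_upwards [eventually_ge_atTop 1] with R hR
      refine .of_forall fun x => ENNReal.div_le_of_le_mul ?_
      rw [← ENNReal.ofReal_mul hC]
      exact hcard R hR x
    · simpa using ENNReal.mul_ne_top ENNReal.ofReal_ne_top (measure_ne_top ν _)
  filter_upwards [hlim.eventually (gt_mem_nhds (ENNReal.ofReal_pos.2 hη)),
    eventually_gt_atTop 0] with R hR hR0
  simp only [div_eq_mul_inv] at hR
  rw [lintegral_mul_const _ (hmeas R), ← div_eq_mul_inv] at hR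
  rw [ENNReal.ofReal_mul hη.le]
  exact (ENNReal.div_le_iff (by positivity) ENNReal.ofReal_ne_top).1 hR.le

end MeanCrossing

section DimensionZero

variable [Subsingleton (E d)] {X : Set (E d)} (v : X → E d)

lemma hasNegligibleCrossing_of_subsingleton : HasNegligibleCrossing v := by
  have hcross (R : ℝ) : crossing v R = ∅ := by
    rw [crossing, Subsingleton.elim v 0, symmDiff_self, Set.bot_eq_empty]
  simp only [HasNegligibleCrossing, hcross, Set.finite_empty, implies_true, Set.ncard_empty,
    Nat.cast_zero, true_and]
  exact isLittleO_zero _ _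

lemma fluctuation_of_subsingleton (ν : Measure (E d)) [IsProbabilityMeasure ν] (R : ℝ) (k : E d) :
    fluctuation v (∫ x, character k x ∂ν) R k = 0 := by
  have hone (x : E d) : character k x = 1 := by
    rw [Subsingleton.elim x 0, character, inner_zero_left, Complex.ofReal_zero, mul_zero,
      Complex.exp_zero]
  simp only [fluctuation, hone, integral_const, probReal_univ, one_smul, mul_one, sub_self,
    finsum_zero]

end DimensionZero

lemma exists_net_isBigO (d : ℕ) : ∃ N : ℕ → Finset (E d),
    (fun n => ((N n).card : ℝ)) =O[atTop] (fun n : ℕ => (n : ℝ) ^ (3 * d)) ∧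
      ∀ (n : ℕ) (k : E d), ‖k‖ ≤ n → ∃ z ∈ N n, dist k z ≤ 1 / ((n : ℝ) + 1) ^ 2 := by
  choose N hcard hN using fun n : ℕ =>
    exists_finset_net (V := E d) n.cast_nonneg (δ := 1 / ((n : ℝ) + 1) ^ 2) (by positivity)
  refine ⟨N, ?_, hN⟩
  have hbase : (fun n : ℕ => 2 * (n : ℝ) / (1 / ((n : ℝ) + 1) ^ 2) + 1)
      =O[atTop] fun n : ℕ => (n : ℝ) ^ 3 := by
    refine .of_bound 9 ?_
    filter_upwards [eventually_ge_atTop 1] with n hn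
    have hn1 : (1 : ℝ) ≤ n := by exact_mod_cast hn
    rw [Real.norm_of_nonneg (by positivity), Real.norm_of_nonneg (by positivity),
      div_div_eq_mul_div, div_one]
    calc 2 * (n : ℝ) * ((n : ℝ) + 1) ^ 2 + 1 ≤ 2 * n * (n + n) ^ 2 + n ^ 3 := by
          gcongr
          exact one_le_pow₀ hn1
      _ = 9 * (n : ℝ) ^ 3 := by ring
  refine .trans (.of_bound' (.of_forall fun n => ?_)) (by simpa only [← pow_mul] using hbase.pow d)
  rw [RCLike.norm_natCast, Real.norm_of_nonneg (by positivity)]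
  simpa only [finrank_euclideanSpace_fin] using hcard n

section AlmostSure

variable {X : Set (E d)} {Ω : Type*} [MeasurableSpace Ω] {P : Measure Ω} {ξ : X → Ω → E d}
  {ν : Measure (E d)} [IsProbabilityMeasure ν] {η : ℝ}

lemma eventually_measureReal_lt_encard_crossing_le (hd : 0 < d) (hX : UniformlyDiscrete X)
    (hindep : iIndepFun ξ P) (hlaw : ∀ p, HasLaw (ξ p) ν P) (hη : 0 < η) :
    ∀ᶠ n : ℕ in atTop, P.real {ω | ENNReal.ofReal (η * (n : ℝ) ^ d)
        < ((crossing (fun p => ξ p ω) n).encard : ENNReal)} ≤ Real.exp (-(η / 2) * n) := by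
  have := hX.countable
  filter_upwards [eventually_ge_atTop 1, tendsto_natCast_atTop_atTop.eventually
    (eventually_lintegral_encard_crossing_le hX ν (η := η / 4) (by positivity))] with n hn hmean
  let S (p : X) : Set (E d) := {x | p ∈ crossing (fun _ => x) n}
  have hS (v : X → E d) : crossing v n = {p | v p ∈ S p} := by
    ext p
    simp only [S, Set.mem_ofPred_eq, mem_crossing]
  have hmeas (p : X) : MeasurableSet (S p) := measurableSet_setOf_mem_crossing p n
  simp only [hS] at hmean ⊢
  rw [lintegral_encard_setOf_mem ν hmeas] at hmean
  have htail := measure_lt_encard_le_exp hindep (fun p => (hlaw p).aemeasurable) hmeas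
    (m := η / 4 * (n : ℝ) ^ d) (by positivity) (by simpa only [(hlaw _).map_eq] using hmean)
    (η * (n : ℝ) ^ d)
  refine (ENNReal.toReal_le_of_le_ofReal (Real.exp_nonneg _) htail).trans (Real.exp_le_exp.2 ?_)
  have hpow : (n : ℝ) ≤ (n : ℝ) ^ d := le_self_pow₀ (by exact_mod_cast hn) hd.ne'
  calc (Real.exp 1 - 1) * (η / 4 * (n : ℝ) ^ d) - η * (n : ℝ) ^ d
      ≤ 2 * (η / 4 * (n : ℝ) ^ d) - η * (n : ℝ) ^ d := by
        gcongr
        linarith [Real.exp_one_lt_d9]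
    _ = -(η / 2 * (n : ℝ) ^ d) := by ring
    _ ≤ -(η / 2) * n := by
        rw [neg_mul]
        gcongr

lemma ae_hasNegligibleCrossing (hd : 0 < d) (hX : UniformlyDiscrete X) (hindep : iIndepFun ξ P)
    (hlaw : ∀ p, HasLaw (ξ p) ν P) : ∀ᵐ ω ∂P, HasNegligibleCrossing fun p => ξ p ω := by
  have := hindep.isProbabilityMeasure
  have hcount (η : ℝ) (hη : 0 < η) : ∀ᵐ ω ∂P, ∀ᶠ n : ℕ in atTop,
      ((crossing (fun p => ξ p ω) n).encard : ENNReal) ≤ ENNReal.ofReal (η * (n : ℝ) ^ d) := by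
    have hBC := ae_eventually_notMem_of_isBigO_exp (P := P) (A := fun n : ℕ => {ω |
      ENNReal.ofReal (η * (n : ℝ) ^ d) < ((crossing (fun p => ξ p ω) n).encard : ENNReal)})
      (half_pos hη) 0 (.of_bound' ?_)
    · exact hBC.mono fun ω hω => hω.mono fun n hn => not_lt.1 hn
    · filter_upwards [eventually_measureReal_lt_encard_crossing_le hd hX hindep hlaw hη] with n hn
      rwa [pow_zero, one_mul, Real.norm_of_nonneg measureReal_nonneg,
        Real.norm_of_nonneg (Real.exp_nonneg _)]
  filter_upwards [ae_forall_pos hcount fun ω η η' h hη => hη.mono fun n hn => hn.trans (by gcongr)]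
    with ω hω
  exact .of_nat hX hω

lemma integral_character_add_sub (hlaw : ∀ p, HasLaw (ξ p) ν P) [IsProbabilityMeasure P]
    (p : X) (k : E d) :
    ∫ ω, (character k ((p : E d) + ξ p ω) - (∫ x, character k x ∂ν) * character k p) ∂P = 0 := by
  have hint : Integrable (fun ω => character k (ξ p ω)) P :=
    ((hlaw p).map_eq ▸ integrable_character ν k).comp_aemeasurable (hlaw p).aemeasurable
  simp only [character_add]
  rw [integral_sub (hint.const_mul _) (integrable_const _), integral_const_mul, integral_const,
    probReal_univ, one_smul, ← (hlaw p).integral_comp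
      (continuous_character_right k).aestronglyMeasurable]
  simp only [Function.comp_apply]
  ring

lemma measureReal_le_norm_fluctuation_le (hX : UniformlyDiscrete X) (hindep : iIndepFun ξ P)
    (hlaw : ∀ p, HasLaw (ξ p) ν P) {R t M : ℝ} (ht : 0 < t)
    (hcard : ((pointsIn (0 : X → E d) R).ncard : ℝ) ≤ M) (k : E d) :
    P.real {ω | t ≤ ‖fluctuation (fun p => ξ p ω) (∫ x, character k x ∂ν) R k‖}
      ≤ 4 * Real.exp (-t ^ 2 / (32 * M)) := by
  have := hindep.isProbabilityMeasure
  have hB := hX.finite_pointsIn_zero R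
  set c := ∫ x, character k x ∂ν
  rcases (pointsIn (0 : X → E d) R).eq_empty_or_nonempty with hempty | hne
  · simp only [fluctuation, hempty, finsum_mem_empty, norm_zero, ht.not_ge, Set.ofPred_false,
      measureReal_empty]
    positivity
  have hg (p : X) : Measurable fun x : E d => character k ((p : E d) + x) - c * character k p :=
    (((continuous_character_right k).comp (continuous_const.add continuous_id)).sub
      continuous_const).measurable
  have htail := measureReal_le_norm_sum_le_exp (s := hB.toFinset) (b := 2) (hindep.comp _ hg)
    (fun p _ => (hg p).comp_aemeasurable (hlaw p).aemeasurable)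
    (fun p _ ω => norm_character_sub_mul_character_le (norm_integral_character_le ν k) _ _ _)
    (fun p _ => integral_character_add_sub hlaw p k) ht.le
  simp only [fluctuation, finsum_mem_eq_finite_toFinset_sum _ hB]
  refine htail.trans ?_
  have hpos : 0 < (pointsIn (0 : X → E d) R).ncard := (Set.ncard_pos hB).2 hne
  rw [← Set.ncard_eq_toFinset_card _ hB, neg_div, neg_div]
  gcongr 4 * Real.exp (-(t ^ 2 / ?_))
  linarith

lemma ae_eventually_norm_fluctuation_le (hd : 0 < d) (hX : UniformlyDiscrete X)
    (hindep : iIndepFun ξ P) (hlaw : ∀ p, HasLaw (ξ p) ν P) {N : ℕ → Finset (E d)} {m : ℕ}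
    (hN : (fun n => ((N n).card : ℝ)) =O[atTop] fun n : ℕ => (n : ℝ) ^ m) (hη : 0 < η) :
    ∀ᵐ ω ∂P, ∀ᶠ n : ℕ in atTop, ∀ z ∈ N n,
      ‖fluctuation (fun p => ξ p ω) (∫ x, character z x ∂ν) n z‖ ≤ η * (n : ℝ) ^ d := by
  have := hindep.isProbabilityMeasure
  obtain ⟨C, hC, hcard⟩ := hX.isBigO_ncard_pointsIn_zero.exists_pos
  let A (n : ℕ) (z : E d) : Set Ω :=
    {ω | η * (n : ℝ) ^ d ≤ ‖fluctuation (fun p => ξ p ω) (∫ x, character z x ∂ν) n z‖}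
  have htail : ∀ᶠ n : ℕ in atTop, ∀ z,
      P.real (A n z) ≤ 4 * Real.exp (-(η ^ 2 / (32 * C)) * n) := by
    filter_upwards [tendsto_natCast_atTop_atTop.eventually hcard.bound, eventually_ge_atTop 1]
      with n hn h1 z
    have hn0 : (0 : ℝ) < n := by exact_mod_cast h1
    rw [Real.norm_of_nonneg (by positivity), Real.norm_of_nonneg (by positivity)] at hn
    refine (measureReal_le_norm_fluctuation_le hX hindep hlaw (by positivity) hn z).trans ?_
    have hexp : -(η * (n : ℝ) ^ d) ^ 2 / (32 * (C * (n : ℝ) ^ d))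
        = -(η ^ 2 / (32 * C)) * (n : ℝ) ^ d := by field_simp
    rw [hexp, neg_mul, neg_mul]
    gcongr
    exact le_self_pow₀ (by exact_mod_cast h1) hd.ne'
  have hunion : (fun n => P.real (⋃ z ∈ N n, A n z))
      =O[atTop] fun n : ℕ => (n : ℝ) ^ m * Real.exp (-(η ^ 2 / (32 * C)) * n) := by
    refine IsBigO.trans (.of_bound 4 ?_) (hN.mul (isBigO_refl _ _))
    filter_upwards [htail] with n hn
    rw [Real.norm_of_nonneg measureReal_nonneg, Real.norm_of_nonneg (by positivity)]
    calc P.real (⋃ z ∈ N n, A n z) ≤ ∑ z ∈ N n, P.real (A n z) := measureReal_biUnion_finset_le _ _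
      _ ≤ (N n).card * (4 * Real.exp (-(η ^ 2 / (32 * C)) * n)) := by
          rw [← nsmul_eq_mul]
          exact Finset.sum_le_card_nsmul _ _ _ fun z _ => hn z
      _ = 4 * ((N n).card * Real.exp (-(η ^ 2 / (32 * C)) * n)) := by ring
  filter_upwards [ae_eventually_notMem_of_isBigO_exp (by positivity) m hunion] with ω hω
  filter_upwards [hω] with n hn z hz
  exact (not_le.1 fun h => hn (Set.mem_biUnion hz h)).le

lemma ae_hasNegligibleCrossing_and_isLittleO_fluctuation (hX : UniformlyDiscrete X)
    (hindep : iIndepFun ξ P) (hlaw : ∀ p, HasLaw (ξ p) ν P) :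
    ∀ᵐ ω ∂P, HasNegligibleCrossing (fun p => ξ p ω) ∧ ∀ k : E d,
      (fun n : ℕ => fluctuation (fun p => ξ p ω) (∫ x, character k x ∂ν) n k)
        =o[atTop] fun n : ℕ => (n : ℝ) ^ d := by
  rcases d.eq_zero_or_pos with rfl | hd
  · refine .of_forall fun ω => ⟨hasNegligibleCrossing_of_subsingleton _, fun k => ?_⟩
    simp only [fluctuation_of_subsingleton]
    exact isLittleO_zero _ _
  obtain ⟨N, hcard, hN⟩ := exists_net_isBigO d
  have hnet := ae_forall_pos
    (fun η hη => ae_eventually_norm_fluctuation_le hd hX hindep hlaw hcard hη)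
    fun ω η η' h hη => hη.mono fun n hn z hz => (hn z hz).trans (by gcongr)
  filter_upwards [ae_hasNegligibleCrossing hd hX hindep hlaw, hnet] with ω hv hω
  exact ⟨hv, fun k => isLittleO_fluctuation_of_net hX hv (continuous_integral_character ν)
    (norm_integral_character_le ν) hN hω k⟩

end AlmostSure

end PerturbedSet

theorem theoremA_general {d : ℕ} (X : Set (E d)) (hX : UniformlyDiscrete X)
    {Ω : Type*} [MeasurableSpace Ω] (P : Measure Ω)
    (ξ : X → Ω → E d) (hindep : iIndepFun ξ P)
    (ν : Measure (E d)) (hlaw : ∀ p, HasLaw (ξ p) ν P) :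
    ∀ᵐ ω ∂P,
      (∀ R : ℝ, {p : X | (p : E d) + ξ p ω ∈ Metric.ball (0 : E d) R}.Finite) ∧
      (∀ k : E d, Tendsto
        (fun R : ℝ => perturbedMeanExp X (fun p => ξ p ω) R k
          - (∫ x, character k x ∂ν) * meanExp X R k) atTop (𝓝 0)) ∧
      (∀ (k : E d) (a : ℂ), HasWeakFourier X k a → Tendsto
        (fun R : ℝ => perturbedMeanExp X (fun p => ξ p ω) R k) atTop
          (𝓝 ((∫ x, character k x ∂ν) * a))) ∧
      (∀ f : E d → ℂ, Continuous f → HasCompactSupport f → Tendsto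
        (fun R : ℝ => ∫ k, f k * (perturbedMeanExp X (fun p => ξ p ω) R k
          - (∫ x, character k x ∂ν) * meanExp X R k)) atTop (𝓝 0)) := by
  have := hindep.isProbabilityMeasure
  rcases X.eq_empty_or_nonempty with rfl | ⟨p, hp⟩
  · have hM (v : (∅ : Set (E d)) → E d) (R : ℝ) (k : E d) : perturbedMeanExp ∅ v R k = 0 := by
      simp [perturbedMeanExp, finsum_of_isEmpty]
    have hS (R : ℝ) (k : E d) : meanExp ∅ R k = 0 := by simp [meanExp, expSum]
    exact .of_forall fun ω => ⟨fun R => Set.toFinite _, by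
      simp +contextual [hM, hS, HasWeakFourier, eq_comm]⟩
  have : IsProbabilityMeasure ν := (hlaw ⟨p, hp⟩).map_eq ▸
    Measure.isProbabilityMeasure_map (hlaw ⟨p, hp⟩).aemeasurable
  filter_upwards [ae_hasNegligibleCrossing_and_isLittleO_fluctuation hX hindep hlaw]
    with ω ⟨hv, hF⟩
  have hlim (k : E d) := hv.tendsto_perturbedMeanExp_sub hX (norm_integral_character_le ν k) (hF k)
  refine ⟨fun R => hX.finite_pointsIn (hv.1 R), hlim, fun k a ha => ?_, fun f hf hfs => ?_⟩
  · simpa using (hlim k).add (Tendsto.const_mul (∫ x, character k x ∂ν) ha)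
  · exact hv.tendsto_integral_mul_perturbedMeanExp_sub hX (continuous_integral_character ν)
      (norm_integral_character_le ν) hlim hf hfs

theorem theoremA {d : ℕ} (X : Set (E d)) (hX : UniformlyDiscrete X)
    (hdens : HasAsymptoticDensity X) (hdiff : HasSingularDiffraction X)
    {Ω : Type*} [MeasurableSpace Ω] (P : Measure Ω) [IsProbabilityMeasure P]
    (ξ : X → Ω → E d) (hindep : iIndepFun ξ P)
    (ν : Measure (E d)) (hlaw : ∀ p, HasLaw (ξ p) ν P)
    (ε : ℝ) (hε : 0 < ε) (hmom : Integrable (fun x : E d => ‖x‖ ^ ((d : ℝ) + ε)) ν) :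
    ∀ᵐ ω ∂P,
      -- the perturbed configuration is locally finite, so that all the sums `M_R` are finite sums
      (∀ R : ℝ, {p : X | (p : E d) + ξ p ω ∈ Metric.ball (0 : E d) R}.Finite) ∧
      -- `M_R(k)` is asymptotic to `𝔼[e^{-2πi⟨ξ,k⟩}]` times the mean defining the weak Fourier
      -- transform of `X` at `k`, for every `k`, whether or not the latter converges
      (∀ k : E d, Tendsto
        (fun R : ℝ => perturbedMeanExp X (fun p => ξ p ω) R k
          - (∫ x, character k x ∂ν) * meanExp X R k) atTop (𝓝 0)) ∧
      -- in particular, the limit formula wherever the weak Fourier transform exists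
      (∀ (k : E d) (a : ℂ), HasWeakFourier X k a → Tendsto
        (fun R : ℝ => perturbedMeanExp X (fun p => ξ p ω) R k) atTop
          (𝓝 ((∫ x, character k x ∂ν) * a))) ∧
      -- the same asymptotics for the measures with these densities, in the vague topology
      (∀ f : E d → ℂ, Continuous f → HasCompactSupport f → Tendsto
        (fun R : ℝ => ∫ k, f k * (perturbedMeanExp X (fun p => ξ p ω) R k
          - (∫ x, character k x ∂ν) * meanExp X R k)) atTop (𝓝 0)) :=
  theoremA_general X hX P ξ hindep ν hlaw
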